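/- Let $(R,\mathfrak m,k)$ be a Noetherian local ring, let $K$ be the Koszul complex on a minimal generating set $x_1,\dots,x_n$ of $\mathfrak m$, viewed as the DG algebra $\bigwedge_R(R^n)$ with $\partial T_i=x_i$. For an ideal $J$ of $R$ let $Z(JK)$ denote the set of cycles and $B(JK)=\partial(JK)$ the set of boundaries of the subcomplex $JK$ of $K$. Let $t\ge 2$ be an integer and let $r\ge 1$ be an odd integer. Suppose that property $\mathcal P_{t,r}$ holds, that is, there is a class $[l]\in H_r(K)$, represented by a cycle $l\in K_r$, such that for every $z\in Z(\mathfrak m^tK)$ there exists $z'\in Z(\mathfrak m^{t-1}K)$ with $z-z'l\in B(\mathfrak m^{t-1}K)$ (a condition that does not depend on the choice of the representative $l$). For any such $l$, let $\mathcal B=K\langle y\mid \partial y=l\rangle$ be obtained from $K$ by adjoining a divided powers variable $y$ of degree $r+1$: $\mathcal B$ is the free $K$-module with basis $\{y^{(j)}\}_{j\ge 0}$, $|y^{(j)}|=j(r+1)$, with differential $$\partial\Big(\sum_j b_jy^{(j)}\Big)=\sum_j\partial(b_j)y^{(j)}+\sum_j(-1)^{|b_j|}b_j\,l\,y^{(j-1)},\qquad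 y^{(-1)}=0 .$$ Then for every $i\ge 0$ the map $$H_i(\mathfrak m^t\mathcal B)\longrightarrow H_i(\mathfrak m^{t-1}\mathcal B)$$ induced by the inclusion $\mathfrak m^t\subseteq\mathfrak m^{t-1}$ is zero. -/

import Mathlib

open CategoryTheory

noncomputable section

namespace KoszulTate

universe u

variable {R : Type u} [CommRing R] {n : ℕ}

/-- `x₁, …, xₙ` is a minimal generating set of the ideal `I`: it generates `I`, and
omitting any one of the `xᵢ` leaves a family that no longer generates `I`. -/
def IsMinimalGeneratingSet (I : Ideal R) (x : Fin n → R) : Prop :=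
  Ideal.span (Set.range x) = I ∧ ∀ i, Ideal.span (x '' {j | j ≠ i}) ≠ I

variable (R n) in
/-- The underlying algebra of the Koszul complex: the exterior algebra of `Rⁿ`, whose
component of homological degree `p` is `⋀[R]^p (Fin n → R)`. -/
abbrev Koszul : Type u := ExteriorAlgebra R (Fin n → R)

variable (R n) in
/-- The component `K_p` of the Koszul complex. -/
abbrev koszulDeg (p : ℕ) : Submodule R (Koszul R n) := ⋀[R]^p (Fin n → R)

/-- The Koszul differential on `x₁, …, xₙ`: contraction with the functional
`v ↦ ∑ i, v i * x i`. It is the `R`-linear map with `∂ 1 = 0`, `∂ Tᵢ = xᵢ`, and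
`∂ (Tᵢ b) = xᵢ b - Tᵢ ∂ b`. -/
def koszulD (x : Fin n → R) : Koszul R n →ₗ[R] Koszul R n :=
  CliffordAlgebra.contractLeft (Fintype.linearCombination R x)

/-- The sign map `b ↦ (-1)^{|b|} b` of the Koszul algebra (see `sgn_of_mem`). -/
def sgn : Koszul R n →ₐ[R] Koszul R n := CliffordAlgebra.involute

theorem koszulD_one (x : Fin n → R) : koszulD x 1 = 0 :=
  CliffordAlgebra.contractLeft_one _ _

theorem koszulD_ι_mul (x : Fin n → R) (v : Fin n → R) (b : Koszul R n) :
    koszulD x (ExteriorAlgebra.ι R v * b) =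
      Fintype.linearCombination R x v • b - ExteriorAlgebra.ι R v * koszulD x b :=
  CliffordAlgebra.contractLeft_ι_mul _ _ _

theorem koszulD_koszulD (x : Fin n → R) (b : Koszul R n) : koszulD x (koszulD x b) = 0 :=
  CliffordAlgebra.contractLeft_contractLeft _ _

theorem sgn_ι (v : Fin n → R) : sgn (ExteriorAlgebra.ι R v) = -ExteriorAlgebra.ι R v :=
  CliffordAlgebra.involute_ι _

theorem sgn_sgn (b : Koszul R n) : sgn (sgn b) = b :=
  CliffordAlgebra.involute_involute _

theorem koszulDeg_induction {C : (p : ℕ) → Koszul R n → Prop}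
    (algebraMap : ∀ a, C 0 (algebraMap R _ a))
    (add : ∀ p a b, C p a → C p b → C p (a + b))
    (ι_mul : ∀ p v b, b ∈ koszulDeg R n p → C p b → C (p + 1) (ExteriorAlgebra.ι R v * b))
    {p : ℕ} {b : Koszul R n} (hb : b ∈ koszulDeg R n p) : C p b := by
  refine Submodule.pow_induction_on_left' _ (C := fun p b _ => C p b) algebraMap
    (fun a b p _ _ h1 h2 => add p a b h1 h2) ?_ hb
  rintro _ ⟨v, rfl⟩ p b hb h
  exact ι_mul p v b hb h

theorem sgn_of_mem {p : ℕ} {b : Koszul R n} (hb : b ∈ koszulDeg R n p) :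
    sgn b = (-1 : ℤ) ^ p • b := by
  refine koszulDeg_induction (C := fun p b => sgn b = (-1 : ℤ) ^ p • b) ?_ ?_ ?_ hb
  · intro a; simp
  · intro p a b ha hb; simp [ha, hb]
  · intro p v b _ h
    rw [map_mul, sgn_ι, h, pow_succ, mul_neg_one, neg_smul, mul_smul_comm, neg_mul, smul_neg]

theorem ι_mul_mem {p : ℕ} (v : Fin n → R) {b : Koszul R n} (hb : b ∈ koszulDeg R n p) :
    ExteriorAlgebra.ι R v * b ∈ koszulDeg R n (p + 1) := by
  rw [koszulDeg, ExteriorAlgebra.exteriorPower, pow_succ']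
  exact Submodule.mul_mem_mul ⟨v, rfl⟩ hb

theorem koszulD_mem_aux (x : Fin n → R) {p : ℕ} {b : Koszul R n} (hb : b ∈ koszulDeg R n p) :
    (p = 0 → koszulD x b = 0) ∧ ∀ q, p = q + 1 → koszulD x b ∈ koszulDeg R n q := by
  refine koszulDeg_induction (C := fun p b =>
    (p = 0 → koszulD x b = 0) ∧ ∀ q, p = q + 1 → koszulD x b ∈ koszulDeg R n q) ?_ ?_ ?_ hb
  · intro a
    refine ⟨fun _ => ?_, fun q hq => absurd hq (by omega)⟩
    rw [Algebra.algebraMap_eq_smul_one, map_smul, koszulD_one, smul_zero]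
  · rintro p a b ⟨h1, h2⟩ ⟨h3, h4⟩
    refine ⟨fun h => by rw [map_add, h1 h, h3 h, add_zero], fun q hq => ?_⟩
    rw [map_add]
    exact add_mem (h2 q hq) (h4 q hq)
  · rintro p v b hb ⟨h1, h2⟩
    refine ⟨fun h => absurd h (by omega), fun q hq => ?_⟩
    obtain rfl : p = q := by omega
    rw [koszulD_ι_mul]
    refine sub_mem (Submodule.smul_mem _ _ hb) ?_
    rcases p with _ | p
    · rw [h1 rfl, mul_zero]; exact zero_mem _
    · exact ι_mul_mem v (h2 p rfl)

theorem koszulD_eq_zero (x : Fin n → R) {b : Koszul R n} (hb : b ∈ koszulDeg R n 0) :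
    koszulD x b = 0 := (koszulD_mem_aux x hb).1 rfl

theorem koszulD_mem (x : Fin n → R) {p : ℕ} {b : Koszul R n} (hb : b ∈ koszulDeg R n (p + 1)) :
    koszulD x b ∈ koszulDeg R n p := (koszulD_mem_aux x hb).2 p rfl

theorem koszulD_sgn (x : Fin n → R) (b : Koszul R n) :
    koszulD x (sgn b) = -sgn (koszulD x b) := by
  induction b using CliffordAlgebra.left_induction with
  | algebraMap a => simp [Algebra.algebraMap_eq_smul_one, koszulD_one]
  | add a b ha hb => simp only [map_add, ha, hb, neg_add]
  | ι_mul b v h =>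
    change koszulD x (sgn (ExteriorAlgebra.ι R v * b)) =
      -sgn (koszulD x (ExteriorAlgebra.ι R v * b))
    rw [map_mul, sgn_ι, neg_mul, map_neg, koszulD_ι_mul, koszulD_ι_mul, map_sub, map_mul, sgn_ι,
      map_smul, h]
    simp

/-- The Leibniz rule. -/
theorem koszulD_mul (x : Fin n → R) (a b : Koszul R n) :
    koszulD x (a * b) = koszulD x a * b + sgn a * koszulD x b := by
  induction a using CliffordAlgebra.left_induction with
  | algebraMap a => simp [Algebra.algebraMap_eq_smul_one, koszulD_one]
  | add a a' ha hb => simp only [map_add, add_mul, ha, hb]; abel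
  | ι_mul a v h =>
    change koszulD x (ExteriorAlgebra.ι R v * a * b) =
      koszulD x (ExteriorAlgebra.ι R v * a) * b + sgn (ExteriorAlgebra.ι R v * a) * koszulD x b
    rw [mul_assoc, koszulD_ι_mul, koszulD_ι_mul, h, map_mul, sgn_ι]
    simp only [mul_add, sub_mul, smul_mul_assoc, mul_assoc, neg_mul]
    abel

theorem ι_mul_comm (v : Fin n → R) (b : Koszul R n) :
    ExteriorAlgebra.ι R v * b = sgn b * ExteriorAlgebra.ι R v := by
  induction b using CliffordAlgebra.left_induction with
  | algebraMap a => simp [Algebra.algebraMap_eq_smul_one]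
  | add a a' ha hb => simp only [map_add, add_mul, mul_add, ha, hb]
  | ι_mul a w h =>
    change ExteriorAlgebra.ι R v * (ExteriorAlgebra.ι R w * a) =
      sgn (ExteriorAlgebra.ι R w * a) * ExteriorAlgebra.ι R v
    have hvw : ExteriorAlgebra.ι R v * ExteriorAlgebra.ι R w =
        -(ExteriorAlgebra.ι R w * ExteriorAlgebra.ι R v) :=
      eq_neg_of_add_eq_zero_left (ExteriorAlgebra.ι_add_mul_swap v w)
    rw [map_mul, sgn_ι, ← mul_assoc, hvw, neg_mul, neg_mul, mul_assoc, h, neg_mul, mul_assoc]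

theorem mul_comm_of_mem {p : ℕ} {a : Koszul R n} (ha : a ∈ koszulDeg R n p) (b : Koszul R n) :
    a * b = sgn^[p] b * a := by
  refine koszulDeg_induction (C := fun p a => ∀ b, a * b = sgn^[p] b * a) ?_ ?_ ?_ ha b
  · intro a b; simp [Algebra.algebraMap_eq_smul_one]
  · intro p a a' h h' b; rw [add_mul, mul_add, h, h']
  · intro p v a _ h b
    rw [mul_assoc, h, ← mul_assoc, ι_mul_comm, mul_assoc, Function.iterate_succ_apply']

theorem sgn_of_odd {p : ℕ} (hp : Odd p) {b : Koszul R n} (hb : b ∈ koszulDeg R n p) :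
    sgn b = -b := by
  rw [sgn_of_mem hb, hp.neg_one_pow, neg_smul, one_smul]

/-- Elements of odd degree of the Koszul algebra have square zero. -/
theorem mul_self_of_odd {p : ℕ} (hp : Odd p) {a : Koszul R n} (ha : a ∈ koszulDeg R n p) :
    a * a = 0 := by
  have hit : ∀ k, Odd k → ∀ b ∈ koszulDeg R n p, sgn^[k] b = -b := by
    rintro k ⟨k, rfl⟩ b hb
    rw [Function.iterate_add_apply, Function.iterate_one, sgn_of_odd hp hb, Function.iterate_mul]
    have h2 : (sgn^[2] : Koszul R n → Koszul R n) = id := by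
      funext c
      exact sgn_sgn c
    rw [h2, Function.iterate_id, id]
  have key : ∀ b ∈ koszulDeg R n p, ∀ c ∈ koszulDeg R n p, b * c + c * b = 0 := by
    intro b hb c hc
    rw [mul_comm_of_mem hb c, hit p hp c hc, neg_mul, neg_add_cancel]
  suffices H : a ∈ koszulDeg R n p ∧ a * a = 0 from H.2
  refine koszulDeg_induction (C := fun q a => q = p → a ∈ koszulDeg R n p ∧ a * a = 0)
    ?_ ?_ ?_ ha rfl
  · intro a h; subst h; exact absurd hp (by decide)
  · intro q a b ha hb hq
    obtain ⟨ha, ha'⟩ := ha hq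
    obtain ⟨hb, hb'⟩ := hb hq
    refine ⟨add_mem ha hb, ?_⟩
    rw [add_mul, mul_add, mul_add, ha', hb', zero_add, add_zero, key a ha b hb]
  · intro q v b hb _ hq
    subst hq
    refine ⟨ι_mul_mem v hb, ?_⟩
    rw [mul_assoc, ← mul_assoc b, mul_comm_of_mem hb, ← mul_assoc, ← mul_assoc]
    have : (sgn^[q] : Koszul R n → Koszul R n) (ExteriorAlgebra.ι R v) ∈
        Submodule.span R {ExteriorAlgebra.ι R v} := by
      generalize q = m
      induction m with
      | zero => exact Submodule.mem_span_singleton_self _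
      | succ m ih =>
        rw [Function.iterate_succ_apply']
        obtain ⟨c, hc⟩ := Submodule.mem_span_singleton.1 ih
        rw [← hc, map_smul, sgn_ι]
        exact Submodule.smul_mem _ _ (neg_mem (Submodule.mem_span_singleton_self _))
    obtain ⟨c, hc⟩ := Submodule.mem_span_singleton.1 this
    rw [← hc]
    simp

/-- `Z_r(K)`, the cycles of degree `r` of the Koszul complex on `x`. -/
def koszulCycles (x : Fin n → R) (r : ℕ) : Submodule R (Koszul R n) :=
  koszulDeg R n r ⊓ LinearMap.ker (koszulD x)

/-- `J • K`, for an ideal `J`, as a submodule of the Koszul complex. -/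
def idealMulKoszul (n : ℕ) (J : Ideal R) : Submodule R (Koszul R n) :=
  J • (⊤ : Submodule R (Koszul R n))

/-- `Z(JK)`, the cycles of the subcomplex `JK` of the Koszul complex on `x`. -/
def cyclesOf (x : Fin n → R) (J : Ideal R) : Submodule R (Koszul R n) :=
  idealMulKoszul n J ⊓ LinearMap.ker (koszulD x)

/-- `B(JK) = ∂(JK)`, the boundaries of the subcomplex `JK` of the Koszul complex on `x`. -/
def boundariesOf (x : Fin n → R) (J : Ideal R) : Submodule R (Koszul R n) :=
  (idealMulKoszul n J).map (koszulD x)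

/-- The cycle `l` of `K_r` represents a class as required in the condition `P_{t,r}`: for every
`z ∈ Z(𝔪^t K)` there is `z' ∈ Z(𝔪^{t-1} K)` with `z - z' l ∈ B(𝔪^{t-1} K)`. Replacing `l` by a
homologous cycle changes `z' l` only by an element of `B(𝔪^{t-1} K)`, so this is a
condition on the class `[l] ∈ H_r(K)`. Thus `P_{t,r}` says that some `l ∈ Z_r(K)` satisfies it. -/
def GeneratesModBoundaries [IsLocalRing R] (x : Fin n → R) (t r : ℕ)
    (l : koszulCycles x r) : Prop :=
  ∀ z ∈ cyclesOf x (IsLocalRing.maximalIdeal R ^ t),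
    ∃ z' ∈ cyclesOf x (IsLocalRing.maximalIdeal R ^ (t - 1)),
      z - z' * (l : Koszul R n) ∈ boundariesOf x (IsLocalRing.maximalIdeal R ^ (t - 1))

/-! ### Adjunction of a divided powers variable

For a cycle `l ∈ K_r` with `r` odd, `K⟨y ∣ ∂y = l⟩ = K ⊗_R R⟨y⟩` is the free `K`-module on the
divided powers `y^(j)`, `j ≥ 0`, where `y^(j)` has degree `(r + 1) j`. The element
`∑ j, b j · y^(j)` is encoded as the finitely supported function `b : ℕ →₀ K`. -/

variable (R n) in
/-- The underlying module of `K⟨y⟩`. -/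
abbrev Adjoin : Type u := ℕ →₀ Koszul R n

/-- The differential of `K⟨y ∣ ∂y = l⟩`:
`∂ (∑ j, b j · y^(j)) = ∑ j, ∂(b j) · y^(j) + ∑ j, (-1)^{|b j|} (b j) l · y^(j-1)`,
where `y^(-1) = 0`. -/
def adjoinD (x : Fin n → R) (l : Koszul R n) : Adjoin R n →ₗ[R] Adjoin R n :=
  Finsupp.mapRange.linearMap (koszulD x) +
    Finsupp.mapRange.linearMap (LinearMap.mulRight R l ∘ₗ sgn.toLinearMap) ∘ₗ
      Finsupp.lcomapDomain Nat.succ Nat.succ_injective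

theorem adjoinD_apply (x : Fin n → R) (l : Koszul R n) (b : Adjoin R n) (j : ℕ) :
    adjoinD x l b j = koszulD x (b j) + sgn (b (j + 1)) * l := rfl

variable (R n) in
/-- The component of degree `i` of `K⟨y⟩`, where `y` has degree `r + 1`: the elements
`∑ j, b j · y^(j)` with `b j ∈ K_{i - (r + 1) j}`, where `K_p = 0` for `p < 0`. -/
def adjoinDeg (r i : ℕ) : Submodule R (Adjoin R n) where
  carrier := {b | ∀ j, b j ∈ if (r + 1) * j ≤ i then koszulDeg R n (i - (r + 1) * j) else ⊥}
  zero_mem' _ := zero_mem _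
  add_mem' ha hb j := add_mem (ha j) (hb j)
  smul_mem' c _ hb j := Submodule.smul_mem _ c (hb j)

theorem adjoinD_mem (x : Fin n → R) {r : ℕ} {l : Koszul R n} (hl : l ∈ koszulDeg R n r)
    {i : ℕ} {b : Adjoin R n} (hb : b ∈ adjoinDeg R n r (i + 1)) :
    adjoinD x l b ∈ adjoinDeg R n r i := by
  intro j
  rw [adjoinD_apply]
  refine add_mem ?_ ?_
  · have h := hb j
    by_cases h1 : (r + 1) * j ≤ i
    · rw [if_pos (by omega), show i + 1 - (r + 1) * j = i - (r + 1) * j + 1 by omega] at h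
      rw [if_pos h1]
      exact koszulD_mem x h
    · have h0 : koszulD x (b j) = 0 := by
        by_cases h2 : (r + 1) * j ≤ i + 1
        · rw [if_pos h2, show i + 1 - (r + 1) * j = 0 by omega] at h
          exact koszulD_eq_zero x h
        · rw [if_neg h2] at h
          rw [(Submodule.mem_bot R).1 h, map_zero]
      rw [h0]
      exact zero_mem _
  · have h := hb (j + 1)
    rw [show (r + 1) * (j + 1) = (r + 1) * j + (r + 1) by ring] at h
    by_cases h1 : (r + 1) * j + (r + 1) ≤ i + 1
    · rw [if_pos h1] at h
      rw [if_pos (by omega), sgn_of_mem h]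
      have := SetLike.mul_mem_graded (A := fun p : ℕ => koszulDeg R n p)
        (zsmul_mem h ((-1) ^ (i + 1 - ((r + 1) * j + (r + 1))))) hl
      rwa [show i + 1 - ((r + 1) * j + (r + 1)) + r = i - (r + 1) * j by omega] at this
    · rw [if_neg h1] at h
      rw [(Submodule.mem_bot R).1 h, map_zero, zero_mul]
      exact zero_mem _

theorem adjoinD_adjoinD (x : Fin n → R) {r : ℕ} (hr : Odd r) (l : koszulCycles x r)
    (b : Adjoin R n) : adjoinD x l (adjoinD x l b) = 0 := by
  obtain ⟨l, hl, hl'⟩ := l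
  replace hl' : koszulD x l = 0 := hl'
  replace hl : l ∈ koszulDeg R n r := hl
  ext j
  simp only [adjoinD_apply, map_add, map_mul, koszulD_koszulD, koszulD_mul, koszulD_sgn, sgn_sgn,
    hl', sgn_of_odd hr hl, add_mul, mul_assoc, neg_mul, mul_self_of_odd hr hl]
  simp

/-- The component of degree `i` of `J·K⟨y⟩`, for an ideal `J`. -/
def idealMulAdjoinDeg (n r : ℕ) (J : Ideal R) (i : ℕ) : Submodule R (Adjoin R n) :=
  J • adjoinDeg R n r i

theorem adjoinD_mem_idealMul (x : Fin n → R) {r : ℕ} {l : Koszul R n} (hl : l ∈ koszulDeg R n r)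
    (J : Ideal R) {i : ℕ} {b : Adjoin R n} (hb : b ∈ idealMulAdjoinDeg n r J (i + 1)) :
    adjoinD x l b ∈ idealMulAdjoinDeg n r J i := by
  have h : adjoinDeg R n r (i + 1) ≤ (adjoinDeg R n r i).comap (adjoinD x l) :=
    fun _ => adjoinD_mem x hl
  have := Submodule.mem_map_of_mem (f := adjoinD x l) (Submodule.smul_mono le_rfl h hb)
  rw [Submodule.map_smul''] at this
  exact Submodule.smul_mono le_rfl (Submodule.map_comap_le _ _) this

/-- The complex of `R`-modules `J·K⟨y ∣ ∂y = l⟩`, for an ideal `J` of `R`, a cycle `l` of odd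
degree `r` of the Koszul complex `K` on `x`. -/
def adjoinComplex (x : Fin n → R) {r : ℕ} (hr : Odd r) (l : koszulCycles x r) (J : Ideal R) :
    ChainComplex (ModuleCat.{u} R) ℕ :=
  ChainComplex.of (fun i => ModuleCat.of R (idealMulAdjoinDeg n r J i))
    (fun _ => ModuleCat.ofHom
      ((adjoinD x (l : Koszul R n)).restrict fun _ => adjoinD_mem_idealMul x l.2.1 J))
    (fun _ => by
      refine ModuleCat.hom_ext (LinearMap.ext fun b => ?_)
      exact Subtype.ext (adjoinD_adjoinD x hr l _))

theorem adjoinComplex_d (x : Fin n → R) {r : ℕ} (hr : Odd r) (l : koszulCycles x r)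
    (J : Ideal R) (i : ℕ) : (adjoinComplex x hr l J).d (i + 1) i = ModuleCat.ofHom
      ((adjoinD x (l : Koszul R n)).restrict fun _ => adjoinD_mem_idealMul x l.2.1 J) :=
  ChainComplex.of_d (fun i => ModuleCat.of R (idealMulAdjoinDeg n r J i))
    (fun _ => ModuleCat.ofHom
      ((adjoinD x (l : Koszul R n)).restrict fun _ => adjoinD_mem_idealMul x l.2.1 J)) i

/-- The inclusion of complexes `I·K⟨y ∣ ∂y = l⟩ → J·K⟨y ∣ ∂y = l⟩` for ideals `I ⊆ J`. -/
def adjoinInclusion (x : Fin n → R) {r : ℕ} (hr : Odd r) (l : koszulCycles x r) {I J : Ideal R}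
    (h : I ≤ J) : adjoinComplex x hr l I ⟶ adjoinComplex x hr l J :=
  ChainComplex.ofHom
    (fun i => ModuleCat.ofHom (Submodule.inclusion
      (Submodule.smul_mono_left (N := adjoinDeg R n r i) h)))
    (fun i => by
      rw [adjoinComplex_d, adjoinComplex_d]
      rfl)

end KoszulTate

end

open CategoryTheory

namespace KoszulTate

universe u

variable {R : Type u} [CommRing R] {n : ℕ}

/-! Let `b = ∑ b_j y^(j)` be a cycle of `𝔪ᵗK⟨y⟩` with top index `m`. Its leading coefficient `b_m`
is a cycle of `𝔪ᵗK`, so `P_{t,r}` gives `b_m = z l + ∂c` with `z` a cycle of `𝔪ᵗ⁻¹K` and `c ∈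
𝔪ᵗ⁻¹K`. The boundary of `± z y^(m+1) + c y^(m)` has the same leading term `b_m y^(m)`; its only
other term is `± c l y^(m-1)`. Subtracting it lowers the top index, and the difference still has
coefficients in `𝔪ᵗK` because `l ∈ 𝔪K`. Induction on the top index (`exists_adjoinD_eq`) makes `b` a
boundary of `𝔪ᵗ⁻¹K⟨y⟩`.

That `l ∈ 𝔪K` (`koszulCycles_le`) is where minimality of the generators and `r > 0` enter. With `∂ᵢ`
the contraction by the `i`-th coordinate, `∂ = ∑ xᵢ ∂ᵢ`, so a cycle has all `∂ᵢ b ∈ 𝔪K`; an element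
of positive degree is controlled by its `∂ᵢ b`.

The induction ignores the grading; projecting the primitive to degree `i + 1` (`adjoinProj`)
restores it. -/

/-! ### Cycles of positive degree lie in the maximal ideal times the Koszul complex -/

/-- A relation between minimal generators of the maximal ideal has coefficients in the
maximal ideal. -/
theorem IsMinimalGeneratingSet.coeff_mem [IsLocalRing R] {x : Fin n → R}
    (hx : IsMinimalGeneratingSet (IsLocalRing.maximalIdeal R) x) {c : Fin n → R}
    (hc : ∑ i, x i * c i = 0) (i : Fin n) : c i ∈ IsLocalRing.maximalIdeal R := by
  rw [IsLocalRing.mem_maximalIdeal, mem_nonunits_iff]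
  -- A unit coefficient `c i` would express `x i` through the other generators.
  rintro ⟨u, hu⟩
  refine hx.2 i (le_antisymm ?_ ?_)
  · rw [← hx.1]
    exact Ideal.span_mono (Set.image_subset_range _ _)
  · rw [← hx.1, Ideal.span_le]
    rintro _ ⟨j, rfl⟩
    have hmem : ∀ j, j ≠ i → x j ∈ Ideal.span (x '' {j | j ≠ i}) := fun j hj =>
      Ideal.subset_span ⟨j, hj, rfl⟩
    by_cases hj : j = i
    · subst hj
      rw [← Finset.add_sum_erase _ _ (Finset.mem_univ j), ← hu] at hc
      have h : x j = (-∑ k ∈ Finset.univ.erase j, x k * c k) * ↑u⁻¹ := by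
        rw [← eq_neg_of_add_eq_zero_left hc, mul_assoc, Units.mul_inv, mul_one]
      rw [h]
      exact Ideal.mul_mem_right _ _ (neg_mem (sum_mem fun k hk =>
        Ideal.mul_mem_right _ _ (hmem k (Finset.ne_of_mem_erase hk))))
    · exact hmem j hj

theorem mem_idealMulKoszul_of_basis {ι : Type*} (B : Module.Basis ι R (Koszul R n)) {J : Ideal R}
    {b : Koszul R n} (h : ∀ i, B.repr b i ∈ J) : b ∈ idealMulKoszul n J := by
  rw [← B.linearCombination_repr b, Finsupp.linearCombination_apply]
  exact sum_mem fun i _ => Submodule.smul_mem_smul (h i) Submodule.mem_top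

theorem map_mem_idealMulKoszul {J : Ideal R} (f : Koszul R n →ₗ[R] Koszul R n) {b : Koszul R n}
    (hb : b ∈ idealMulKoszul n J) : f b ∈ idealMulKoszul n J := by
  have h := Submodule.mem_map_of_mem (f := f) hb
  rw [idealMulKoszul, Submodule.map_smul''] at h
  exact Submodule.smul_mono le_rfl le_top h

theorem koszulD_eq_sum (x : Fin n → R) (b : Koszul R n) :
    koszulD x b = ∑ i, x i • koszulD (Pi.single i 1) b := by
  have h : Fintype.linearCombination R x =
      ∑ i, x i • Fintype.linearCombination R (Pi.single i (1 : R)) := by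
    ext j
    simp [Fintype.linearCombination_apply, Pi.single_apply]
  simp only [koszulD, h, map_sum, map_smul, LinearMap.sum_apply, LinearMap.smul_apply]

/-- The exterior algebra is free, so each coordinate of `∂b = ∑ xᵢ ∂ᵢ b = 0` is a linear relation
among the minimal generators. -/
theorem koszulD_single_mem [IsLocalRing R] {x : Fin n → R}
    (hx : IsMinimalGeneratingSet (IsLocalRing.maximalIdeal R) x) {b : Koszul R n}
    (hb : koszulD x b = 0) (i : Fin n) :
    koszulD (Pi.single i 1) b ∈ idealMulKoszul n (IsLocalRing.maximalIdeal R) := by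
  let B := (Pi.basisFun R (Fin n)).ExteriorAlgebra
  refine mem_idealMulKoszul_of_basis B fun s => ?_
  refine hx.coeff_mem (c := fun i => B.repr (koszulD (Pi.single i 1) b) s) ?_ i
  have h := congrArg (fun c => B.repr c s) ((koszulD_eq_sum x b).symm.trans hb)
  simpa using h

/-- Setting `Tᵢ = 0` in the Koszul algebra. -/
theorem map_sub_single (i : Fin n) (b : Koszul R n) :
    ExteriorAlgebra.map (LinearMap.id - LinearMap.single R (fun _ => R) i ∘ₗ LinearMap.proj i) b =
      b - ExteriorAlgebra.ι R (Pi.single i 1) * koszulD (Pi.single i 1) b := by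
  induction b using CliffordAlgebra.left_induction with
  | algebraMap a => simp [Algebra.algebraMap_eq_smul_one, koszulD_one]
  | add a b ha hb => simp only [map_add, ha, hb, mul_add]; abel
  | ι_mul b v h =>
    change ExteriorAlgebra.map _ (ExteriorAlgebra.ι R v * b) =
      ExteriorAlgebra.ι R v * b - ExteriorAlgebra.ι R (Pi.single i 1) *
        koszulD (Pi.single i 1) (ExteriorAlgebra.ι R v * b)
    have h1 : (LinearMap.id - LinearMap.single R (fun _ => R) i ∘ₗ LinearMap.proj i :
        (Fin n → R) →ₗ[R] Fin n → R) v = v - v i • Pi.single i 1 := by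
      ext j
      simp [Pi.single_apply]
    have h2 : Fintype.linearCombination R (Pi.single i (1 : R)) v = v i := by
      simp [Fintype.linearCombination_apply, Pi.single_apply]
    have h3 : ExteriorAlgebra.ι R v * ExteriorAlgebra.ι R (Pi.single i 1) =
        -(ExteriorAlgebra.ι R (Pi.single i 1) * ExteriorAlgebra.ι R v) :=
      eq_neg_of_add_eq_zero_left (ExteriorAlgebra.ι_add_mul_swap _ _)
    rw [map_mul, h, ExteriorAlgebra.map_apply_ι, h1, koszulD_ι_mul, h2, map_sub, map_smul]
    simp only [sub_mul, mul_sub, smul_mul_assoc, mul_smul_comm, ← mul_assoc, h3,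
      ExteriorAlgebra.ι_sq_zero, zero_mul, smul_zero, neg_mul]
    abel

theorem map_zero_of_mem {p : ℕ} {b : Koszul R n} (hb : b ∈ koszulDeg R n (p + 1)) :
    ExteriorAlgebra.map (0 : (Fin n → R) →ₗ[R] Fin n → R) b = 0 := by
  refine koszulDeg_induction (C := fun q b => q ≠ 0 →
    ExteriorAlgebra.map (0 : (Fin n → R) →ₗ[R] Fin n → R) b = 0) ?_ ?_ ?_ hb p.succ_ne_zero
  · intro a h; exact absurd rfl h
  · intro q a b ha hb h; rw [map_add, ha h, hb h, add_zero]
  · intro q v b _ _ _; simp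

/-- An element of positive degree all of whose partial derivatives lie in `JK` lies in `JK`. -/
theorem mem_idealMulKoszul_of_koszulD_single {J : Ideal R} {p : ℕ} {b : Koszul R n}
    (hb : b ∈ koszulDeg R n (p + 1))
    (h : ∀ i, koszulD (Pi.single i 1) b ∈ idealMulKoszul n J) : b ∈ idealMulKoszul n J := by
  -- The variables `Tᵢ`, `i ∈ s`, are set to zero one at a time, each at a cost in `JK`. Euler's
  -- formula `∑ Tᵢ ∂ᵢ b = (p + 1) b` would not suffice, as `p + 1` need not be invertible.
  have key : ∀ s : Finset (Fin n), ∃ f : (Fin n → R) →ₗ[R] Fin n → R,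
      (∀ v, ∀ i ∈ s, f v i = 0) ∧ b - ExteriorAlgebra.map f b ∈ idealMulKoszul n J := by
    intro s
    induction s using Finset.induction_on with
    | empty => exact ⟨LinearMap.id, by simp, by simp⟩
    | insert i s _ ih =>
      obtain ⟨f, hf, hfb⟩ := ih
      let g : (Fin n → R) →ₗ[R] Fin n → R :=
        LinearMap.id - LinearMap.single R (fun _ => R) i ∘ₗ LinearMap.proj i
      refine ⟨g ∘ₗ f, fun v j hj => ?_, ?_⟩
      · by_cases hji : j = i
        · subst hji
          simp [g]
        · simp [g, hf v j (Finset.mem_of_mem_insert_of_ne hj hji), hji]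
      · have h1 := map_mem_idealMulKoszul (ExteriorAlgebra.map g).toLinearMap hfb
        have h2 := map_mem_idealMulKoszul
          (LinearMap.mulLeft R (ExteriorAlgebra.ι R (Pi.single i (1 : R)))) (h i)
        have h3 := map_sub_single i b
        have h4 := DFunLike.congr_fun (ExteriorAlgebra.map_comp_map f g) b
        rw [AlgHom.comp_apply] at h4
        -- `b - g(f(b)) = g(b - f(b)) + Tᵢ ∂ᵢ b`, by `map_sub_single`.
        convert add_mem h1 h2 using 1
        rw [AlgHom.toLinearMap_apply, map_sub, h4, LinearMap.mulLeft_apply, h3]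
        abel
  obtain ⟨f, hf, hfb⟩ := key Finset.univ
  obtain rfl : f = 0 := LinearMap.ext fun v => funext fun i => hf v i (Finset.mem_univ i)
  rwa [map_zero_of_mem hb, sub_zero] at hfb

theorem koszulCycles_le [IsLocalRing R] {x : Fin n → R}
    (hx : IsMinimalGeneratingSet (IsLocalRing.maximalIdeal R) x) (p : ℕ) :
    koszulCycles x (p + 1) ≤ idealMulKoszul n (IsLocalRing.maximalIdeal R) :=
  fun _ hb => mem_idealMulKoszul_of_koszulD_single hb.1 (koszulD_single_mem hx hb.2)

theorem mul_mem_idealMulKoszul {I J : Ideal R} {a b : Koszul R n} (ha : a ∈ idealMulKoszul n I)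
    (hb : b ∈ idealMulKoszul n J) : a * b ∈ idealMulKoszul n (I * J) := by
  refine Submodule.smul_induction_on ha (fun c hc a _ => ?_) fun a a' h h' => ?_
  · have h := map_mem_idealMulKoszul (LinearMap.mulLeft R a) hb
    rw [LinearMap.mulLeft_apply] at h
    rw [smul_mul_assoc, idealMulKoszul, Submodule.mul_smul]
    exact Submodule.smul_mem_smul hc h
  · rw [add_mul]
    exact add_mem h h'

/-! ### The homogeneous components of `K⟨y⟩` -/

/-- The projection of the Koszul algebra to its component of degree `i - m`, which is zero if
`i < m`. -/
noncomputable def koszulProj (i m : ℕ) : Koszul R n →ₗ[R] Koszul R n :=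
  if m ≤ i then GradedAlgebra.proj (fun p : ℕ => koszulDeg R n p) (i - m) else 0

theorem koszulProj_of_le {i m : ℕ} (h : m ≤ i) (b : Koszul R n) :
    koszulProj i m b = DirectSum.decompose (fun p : ℕ => koszulDeg R n p) b (i - m) := by
  rw [koszulProj, if_pos h, GradedAlgebra.proj_apply]

theorem koszulProj_of_not_le {i m : ℕ} (h : ¬m ≤ i) (b : Koszul R n) : koszulProj i m b = 0 := by
  rw [koszulProj, if_neg h, LinearMap.zero_apply]

theorem koszulProj_mem (i m : ℕ) (b : Koszul R n) :
    koszulProj i m b ∈ if m ≤ i then koszulDeg R n (i - m) else ⊥ := by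
  split_ifs with h
  · rw [koszulProj_of_le h]
    exact SetLike.coe_mem _
  · exact koszulProj_of_not_le h b

theorem koszulProj_eq_self {i m : ℕ} {b : Koszul R n}
    (hb : b ∈ if m ≤ i then koszulDeg R n (i - m) else ⊥) : koszulProj i m b = b := by
  split_ifs at hb with h
  · rw [koszulProj_of_le h, DirectSum.decompose_of_mem_same _ hb]
  · rw [koszulProj_of_not_le h, (Submodule.mem_bot R).1 hb]

theorem koszulProj_of_mem {i m p : ℕ} {b : Koszul R n} (hb : b ∈ koszulDeg R n p) :
    koszulProj i m b = if p + m = i then b else 0 := by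
  by_cases h : m ≤ i
  · rw [koszulProj_of_le h]
    split_ifs with h'
    · obtain rfl : p = i - m := by omega
      exact DirectSum.decompose_of_mem_same _ hb
    · exact DirectSum.decompose_of_mem_ne _ hb (by omega)
  · rw [koszulProj_of_not_le h, if_neg (by omega)]

/-- An additive property of homogeneous elements holds on the whole Koszul algebra. -/
theorem koszul_induction {C : Koszul R n → Prop} (zero : C 0)
    (add : ∀ a b, C a → C b → C (a + b)) (homogeneous : ∀ p, ∀ b ∈ koszulDeg R n p, C b)
    (b : Koszul R n) : C b :=
  DirectSum.Decomposition.inductionOn (fun p : ℕ => koszulDeg R n p) zero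
    (fun {p} b => homogeneous p b b.2) add b

theorem koszulProj_koszulD (x : Fin n → R) (i m : ℕ) (b : Koszul R n) :
    koszulProj i m (koszulD x b) = koszulD x (koszulProj (i + 1) m b) := by
  induction b using koszul_induction with
  | zero => simp
  | add a b ha hb => simp only [map_add, ha, hb]
  | homogeneous p b hb =>
    rw [koszulProj_of_mem hb]
    rcases p with _ | p
    · rw [koszulD_eq_zero x hb]
      split_ifs <;> simp [koszulD_eq_zero x hb]
    · rw [koszulProj_of_mem (koszulD_mem x hb)]
      by_cases h : p + m = i
      · rw [if_pos h, if_pos (by omega)]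
      · rw [if_neg h, if_neg (by omega), map_zero]

/-- The shift of `m` by `r + 1` is the passage from the degree of `y^(j)` to that of `y^(j+1)`. -/
theorem koszulProj_sgn_mul {r : ℕ} {l : Koszul R n} (hl : l ∈ koszulDeg R n r) (i m : ℕ)
    (b : Koszul R n) :
    koszulProj i m (sgn b * l) = sgn (koszulProj (i + 1) (m + (r + 1)) b) * l := by
  induction b using koszul_induction with
  | zero => simp
  | add a b ha hb => simp only [map_add, add_mul, ha, hb]
  | homogeneous p b hb =>
    have h : sgn b * l ∈ koszulDeg R n (p + r) := by
      rw [sgn_of_mem hb]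
      exact SetLike.mul_mem_graded (A := fun p : ℕ => koszulDeg R n p) (zsmul_mem hb _) hl
    rw [koszulProj_of_mem hb, koszulProj_of_mem h]
    by_cases h : p + r + m = i
    · rw [if_pos h, if_pos (by omega)]
    · rw [if_neg h, if_neg (by omega), map_zero, zero_mul]

/-- The projection of `K⟨y⟩` to its component of degree `i`. -/
noncomputable def adjoinProj (r i : ℕ) : Adjoin R n →ₗ[R] Adjoin R n where
  toFun b := Finsupp.onFinset b.support (fun j => koszulProj i ((r + 1) * j) (b j)) fun j hj => by
    rw [Finsupp.mem_support_iff]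
    rintro h
    rw [h, map_zero] at hj
    exact hj rfl
  map_add' a b := by ext j; simp
  map_smul' c b := by ext j; simp

theorem adjoinProj_apply (r i : ℕ) (b : Adjoin R n) (j : ℕ) :
    adjoinProj r i b j = koszulProj i ((r + 1) * j) (b j) := rfl

theorem adjoinProj_mem (r i : ℕ) (b : Adjoin R n) : adjoinProj r i b ∈ adjoinDeg R n r i :=
  fun j => koszulProj_mem i ((r + 1) * j) (b j)

theorem adjoinProj_eq_self {r i : ℕ} {b : Adjoin R n} (hb : b ∈ adjoinDeg R n r i) :
    adjoinProj r i b = b :=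
  Finsupp.ext fun j => koszulProj_eq_self (hb j)

theorem adjoinProj_adjoinD (x : Fin n → R) {r : ℕ} {l : Koszul R n} (hl : l ∈ koszulDeg R n r)
    (i : ℕ) (b : Adjoin R n) :
    adjoinProj r i (adjoinD x l b) = adjoinD x l (adjoinProj r (i + 1) b) := by
  ext j
  rw [adjoinProj_apply, adjoinD_apply, adjoinD_apply, adjoinProj_apply, adjoinProj_apply, map_add,
    koszulProj_koszulD, koszulProj_sgn_mul hl, mul_add_one]

/-- Linearity of the projection carries `J • ⊤` into `J` times the degree `i` component, so no
separate comparison with the intersection is needed. -/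
theorem adjoinProj_mem_idealMul (r i : ℕ) {J : Ideal R} {b : Adjoin R n}
    (hb : ∀ j, b j ∈ idealMulKoszul n J) : adjoinProj r i b ∈ idealMulAdjoinDeg n r J i := by
  have hb' : b ∈ J • (⊤ : Submodule R (Adjoin R n)) := by
    rw [← Finsupp.sum_single b]
    refine sum_mem fun j _ => ?_
    have h := Submodule.mem_map_of_mem (f := Finsupp.lsingle (R := R) j) (hb j)
    rw [idealMulKoszul, Submodule.map_smul''] at h
    exact Submodule.smul_mono le_rfl le_top h
  have h := Submodule.mem_map_of_mem (f := adjoinProj r i) hb'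
  rw [Submodule.map_smul''] at h
  refine Submodule.smul_mono le_rfl ?_ h
  rintro _ ⟨b, -, rfl⟩
  exact adjoinProj_mem r i b

theorem apply_mem_of_mem_idealMul {r i : ℕ} {J : Ideal R} {b : Adjoin R n}
    (hb : b ∈ idealMulAdjoinDeg n r J i) (j : ℕ) : b j ∈ idealMulKoszul n J := by
  have h := Submodule.mem_map_of_mem (f := Finsupp.lapply (R := R) j) hb
  rw [idealMulAdjoinDeg, Submodule.map_smul''] at h
  exact Submodule.smul_mono le_rfl le_top h

theorem adjoinD_eq_zero (x : Fin n → R) (l : Koszul R n) {r : ℕ} {b : Adjoin R n}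
    (hb : b ∈ adjoinDeg R n r 0) : adjoinD x l b = 0 := by
  have h : ∀ j, b (j + 1) = 0 := fun j => by
    have h := hb (j + 1)
    rwa [if_neg (by rw [mul_add_one]; omega), Submodule.mem_bot] at h
  have h0 : b 0 ∈ koszulDeg R n 0 := by simpa using hb 0
  ext j
  rw [adjoinD_apply, h, map_zero, zero_mul, add_zero, Finsupp.zero_apply]
  rcases j with _ | j
  · exact koszulD_eq_zero x h0
  · rw [h, map_zero]

/-! ### Cycles of `𝔪ᵗK⟨y⟩` are boundaries of `𝔪ᵗ⁻¹K⟨y⟩` -/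

theorem adjoinD_single_apply (x : Fin n → R) (l a : Koszul R n) (m j : ℕ) :
    adjoinD x l (Finsupp.single m a) j =
      (if m = j then koszulD x a else 0) + if m = j + 1 then sgn a * l else 0 := by
  rw [adjoinD_apply, Finsupp.single_apply, Finsupp.single_apply]
  split_ifs <;> simp

theorem exists_adjoinD_eq [IsLocalRing R] {x : Fin n → R}
    (hx : IsMinimalGeneratingSet (IsLocalRing.maximalIdeal R) x) {t r : ℕ} (ht : 1 ≤ t)
    (hr : Odd r) (l : koszulCycles x r) (hP : GeneratesModBoundaries x t r l) {b : Adjoin R n}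
    (hb : ∀ j, b j ∈ idealMulKoszul n (IsLocalRing.maximalIdeal R ^ t))
    (hbD : adjoinD x (l : Koszul R n) b = 0) :
    ∃ a : Adjoin R n, (∀ j, a j ∈ idealMulKoszul n (IsLocalRing.maximalIdeal R ^ (t - 1))) ∧
      adjoinD x (l : Koszul R n) a = b := by
  have hl : (l : Koszul R n) ∈ idealMulKoszul n (IsLocalRing.maximalIdeal R) := by
    obtain ⟨p, rfl⟩ : ∃ p, r = p + 1 := ⟨r - 1, by have := hr.pos; omega⟩
    exact koszulCycles_le hx p l.2
  -- Here `m` is a strict upper bound for the indices in the support of `b`.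
  suffices H : ∀ m : ℕ, ∀ b : Adjoin R n, (∀ j, m ≤ j → b j = 0) →
      (∀ j, b j ∈ idealMulKoszul n (IsLocalRing.maximalIdeal R ^ t)) →
      adjoinD x (l : Koszul R n) b = 0 →
      ∃ a : Adjoin R n, (∀ j, a j ∈ idealMulKoszul n (IsLocalRing.maximalIdeal R ^ (t - 1))) ∧
        adjoinD x (l : Koszul R n) a = b by
    refine H (b.support.sup id + 1) b (fun j hj => ?_) hb hbD
    by_contra h
    have := Finset.le_sup (f := id) (Finsupp.mem_support_iff.2 h)
    simp only [id] at this
    omega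
  intro m
  induction m with
  | zero =>
    intro b hb0 _ _
    obtain rfl : b = 0 := Finsupp.ext fun j => hb0 j j.zero_le
    exact ⟨0, fun _ => zero_mem _, map_zero _⟩
  | succ m ih =>
    intro b hb0 hb hbD
    have hcyc : koszulD x (b m) = 0 := by
      have h := DFunLike.congr_fun hbD m
      rwa [adjoinD_apply, hb0 (m + 1) le_rfl, map_zero, zero_mul, add_zero] at h
    obtain ⟨z, hz, c, hc, hzc⟩ := hP (b m) ⟨hb m, hcyc⟩
    have hzD : koszulD x z = 0 := hz.2
    -- The differential applies `sgn` to coefficients before multiplying by `l`, so `sgn z`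
    -- contributes exactly `z l` at index `m`; it adds nothing at `m + 1` since `z` is a cycle.
    let a : Adjoin R n := Finsupp.single (m + 1) (sgn z) + Finsupp.single m c
    have ha : ∀ j, adjoinD x (l : Koszul R n) a j =
        (if m = j then b m else 0) + if m = j + 1 then sgn c * (l : Koszul R n) else 0 := by
      intro j
      rw [map_add, Finsupp.add_apply, adjoinD_single_apply, adjoinD_single_apply, koszulD_sgn, hzD,
        sgn_sgn, hzc]
      simp only [add_left_inj]
      by_cases hj : m = j
      · subst hj
        simp
      · simp [hj]
    have haJ : ∀ j, a j ∈ idealMulKoszul n (IsLocalRing.maximalIdeal R ^ (t - 1)) := by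
      intro j
      rw [Finsupp.add_apply, Finsupp.single_apply, Finsupp.single_apply]
      refine add_mem ?_ ?_
      · split_ifs
        · exact map_mem_idealMulKoszul sgn.toLinearMap hz.1
        · exact zero_mem _
      · split_ifs
        · exact hc
        · exact zero_mem _
    -- The factor `l ∈ 𝔪K` regains the power of `𝔪` lost in passing from `b m` to `c`.
    have hcl : sgn c * (l : Koszul R n) ∈ idealMulKoszul n (IsLocalRing.maximalIdeal R ^ t) := by
      have h := mul_mem_idealMulKoszul (map_mem_idealMulKoszul sgn.toLinearMap hc) hl
      rwa [← pow_succ, Nat.sub_add_cancel ht] at h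
    have hb0' : ∀ j, m ≤ j → (b - adjoinD x (l : Koszul R n) a) j = 0 := by
      intro j hj
      rw [Finsupp.sub_apply, ha, if_neg (by omega : ¬m = j + 1), add_zero]
      split_ifs with h
      · rw [h, sub_self]
      · rw [hb0 j (by omega), sub_zero]
    have hb' : ∀ j, (b - adjoinD x (l : Koszul R n) a) j ∈
        idealMulKoszul n (IsLocalRing.maximalIdeal R ^ t) := by
      intro j
      rw [Finsupp.sub_apply, ha]
      refine sub_mem (hb j) (add_mem ?_ ?_)
      · split_ifs
        · exact hb m
        · exact zero_mem _
      · split_ifs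
        · exact hcl
        · exact zero_mem _
    obtain ⟨a', ha', ha'D⟩ := ih _ hb0' hb' (by rw [map_sub, hbD, adjoinD_adjoinD x hr, sub_zero])
    exact ⟨a' + a, fun j => add_mem (ha' j) (haJ j), by rw [map_add, ha'D, sub_add_cancel]⟩

end KoszulTate

/-! ### Passage to homology -/

/-- A morphism of complexes of modules is zero in homology if it sends cycles to boundaries. -/
theorem HomologicalComplex.homologyMap_eq_zero_of_cycles {R : Type*} [Ring R]
    {C D : ChainComplex (ModuleCat R) ℕ} (φ : C ⟶ D) (i : ℕ)
    (h : ∀ z : C.X i, C.d i ((ComplexShape.down ℕ).next i) z = 0 →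
      ∃ w : D.X (i + 1), D.d (i + 1) i w = φ.f i z) :
    HomologicalComplex.homologyMap φ i = 0 := by
  rw [← cancel_epi (C.homologyπ i), HomologicalComplex.homologyπ_naturality, Limits.comp_zero]
  ext z
  obtain ⟨w, hw⟩ := h (C.iCycles i z) (by
    rw [← ModuleCat.comp_apply, HomologicalComplex.iCycles_d]; rfl)
  -- Cycles embed in the chain module, so the equality can be tested there.
  have hz : HomologicalComplex.cyclesMap φ i z = D.toCycles (i + 1) i w := by
    apply (ModuleCat.mono_iff_injective (D.iCycles i)).1 inferInstance
    rw [← ModuleCat.comp_apply, ← ModuleCat.comp_apply, HomologicalComplex.cyclesMap_i,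
      HomologicalComplex.toCycles_i, ModuleCat.comp_apply, hw]
  rw [ModuleCat.comp_apply, hz, ← ModuleCat.comp_apply, HomologicalComplex.toCycles_comp_homologyπ]
  rfl

theorem theorem4p2 {R : Type*} [CommRing R] [IsLocalRing R] [IsNoetherianRing R]
    {n : ℕ} (x : Fin n → R)
    (hx : KoszulTate.IsMinimalGeneratingSet (IsLocalRing.maximalIdeal R) x)
    (t r : ℕ) (ht : 2 ≤ t) (hr : Odd r)
    (l : KoszulTate.koszulCycles x r)
    (hP : KoszulTate.GeneratesModBoundaries x t r l) (i : ℕ) :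
    HomologicalComplex.homologyMap
      (KoszulTate.adjoinInclusion x hr l
        (Ideal.pow_le_pow_right (I := IsLocalRing.maximalIdeal R) (Nat.sub_le t 1))) i = 0 := by
  refine HomologicalComplex.homologyMap_eq_zero_of_cycles _ i fun z hz => ?_
  obtain ⟨b, hb⟩ : KoszulTate.idealMulAdjoinDeg n r (IsLocalRing.maximalIdeal R ^ t) i := z
  have hdeg : b ∈ KoszulTate.adjoinDeg R n r i := Submodule.smul_le_right hb
  have hbD : KoszulTate.adjoinD x (l : KoszulTate.Koszul R n) b = 0 := by
    -- In degree `0` the hypothesis `hz` is vacuous, but `adjoinD` vanishes there for degree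
    -- reasons.
    rcases i with _ | i
    · exact KoszulTate.adjoinD_eq_zero x l hdeg
    · rw [ChainComplex.next_nat_succ, KoszulTate.adjoinComplex_d] at hz
      exact congrArg Subtype.val hz
  obtain ⟨a, ha, haD⟩ := KoszulTate.exists_adjoinD_eq hx (by omega) hr l hP
    (KoszulTate.apply_mem_of_mem_idealMul hb) hbD
  -- `a` need not be homogeneous; since `b` has degree `i`, the degree `i + 1` component of `a` has
  -- the same boundary `b`.
  refine ⟨⟨KoszulTate.adjoinProj r (i + 1) a, KoszulTate.adjoinProj_mem_idealMul r (i + 1) ha⟩, ?_⟩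
  rw [KoszulTate.adjoinComplex_d]
  refine Subtype.ext ?_
  change KoszulTate.adjoinD x l (KoszulTate.adjoinProj r (i + 1) a) = b
  rw [← KoszulTate.adjoinProj_adjoinD x l.2.1, haD, KoszulTate.adjoinProj_eq_self hdeg]
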